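/- Let $d,k,n\in\mathbb{N}$ with $n\ge k\ge 2$, let $x_1,\dots,x_n\in\mathbb{R}^d$ be distinct points with weights $\omega_1,\dots,\omega_n>0$, and let $\kappa^-,\kappa^+\in\mathbb{R}^k$ satisfy $0<\kappa_i^-\le\kappa_i^+$ for all $i\le k$ and $\sum_{i=1}^k\kappa_i^-\le\sum_{j=1}^n\omega_j\le\sum_{i=1}^k\kappa_i^+$. The weight-balanced partition polytope is the set of all $y=(y_{ij})\in\mathbb{R}^{k\times n}$ with $y_{ij}\ge 0$ for all $i,j$, $\sum_{i=1}^k y_{ij}=1$ for all $j\le n$, and $\kappa_i^-\le\sum_{j=1}^n y_{ij}\omega_j\le\kappa_i^+$ for all $i\le k$. For sites $S=(s_1,\dots,s_k)$ in $\mathbb{R}^d$ put $\Theta(y,S)=\sum_{i=1}^k\sum_{j=1}^n y_{ij}\omega_j\,(s_i^Ts_i-2x_j^Ts_i)$. Weight-balanced $k$-means starts from arbitrary sites $S^{(1)}$ in $\mathbb{R}^d$. In iteration $l=1,2,\dots$ it (1) computes an arbitrary vertex $y^{(l)}$ of the weight-balanced partition polytope that minimizes $\Theta(\cdot,S^{(l)})$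 over this polytope, and (2) lets $S^{(l+1)}$ consist of the centers of gravity $$s_i^{(l+1)}=\frac{1}{\sum_{j=1}^n y^{(l)}_{ij}\omega_j}\sum_{j=1}^n y^{(l)}_{ij}\omega_j x_j\qquad(i\le k).$$ It stops after iteration $l\ge 2$ if the objective function value did not decrease, that is, unless $\Theta(y^{(l)},S^{(l)})<\Theta(y^{(l-1)},S^{(l-1)})$; otherwise it continues with iteration $l+1$. Then every run of weight-balanced $k$-means performs at most $(40e\,k^2 n)^{(d+1)k-1}$ iterations, where $e$ is the Euler number. -/

import Mathlib

namespace WeightBalancedKMeans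

/-- Assignment vectors: `y i j` is the fraction of the weight of point `j` that belongs to
cluster `i`. -/
abbrev Assignment (k n : ℕ) := Fin k → Fin n → ℝ

/-- Tuples of `k` sites in Euclidean `d`-space. Coinciding sites are allowed. -/
abbrev Sites (d k : ℕ) := Fin k → EuclideanSpace ℝ (Fin d)

/-- The size (total weight) of the `i`-th cluster. -/
def clusterSize {k n : ℕ} (ω : Fin n → ℝ) (y : Assignment k n) (i : Fin k) : ℝ :=
  ∑ j, y i j * ω j

/-- The weight-balanced partition polytope. -/
def partitionPolytope {k n : ℕ} (ω : Fin n → ℝ) (κlo κhi : Fin k → ℝ) :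
    Set (Assignment k n) :=
  {y | (∀ i, κlo i ≤ clusterSize ω y i ∧ clusterSize ω y i ≤ κhi i) ∧
    (∀ j, ∑ i, y i j = 1) ∧ ∀ i j, 0 ≤ y i j}

/-- The center of gravity of the `i`-th cluster. -/
noncomputable def centerOfGravity {d k n : ℕ} (x : Fin n → EuclideanSpace ℝ (Fin d))
    (ω : Fin n → ℝ) (y : Assignment k n) (i : Fin k) : EuclideanSpace ℝ (Fin d) :=
  (clusterSize ω y i)⁻¹ • ∑ j, (y i j * ω j) • x j

/-- The least-squares objective of an assignment `y` for sites `s`, up to the additive constant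
`∑ j, ω j * ‖x j‖ ^ 2`. -/
noncomputable def objective {d k n : ℕ} (x : Fin n → EuclideanSpace ℝ (Fin d))
    (ω : Fin n → ℝ) (s : Sites d k) (y : Assignment k n) : ℝ :=
  ∑ i, ∑ j, y i j * ω j * (inner ℝ (s i) (s i) - 2 * inner ℝ (x j) (s i))

/-- `y` is a possible result of the assignment step for the sites `s`: an optimal basic feasible
solution, that is, an optimal vertex, of the linear program that minimizes the objective over the
weight-balanced partition polytope. -/
def IsOptimalVertex {d k n : ℕ} (x : Fin n → EuclideanSpace ℝ (Fin d)) (ω : Fin n → ℝ)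
    (κlo κhi : Fin k → ℝ) (s : Sites d k) (y : Assignment k n) : Prop :=
  y ∈ Set.extremePoints ℝ (partitionPolytope ω κlo κhi) ∧
    IsMinOn (objective x ω s) (partitionPolytope ω κlo κhi) y

/-- `IsExecution x ω κlo κhi s₀ N s y`: weight-balanced `k`-means, started with the sites `s₀`,
can perform `N` iterations (and has possibly not stopped yet), where iteration number
`l = 0, …, N - 1` uses the sites `s l` and computes the assignment `y l`.
Values of `s` after `N` and of `y` from `N` on are irrelevant. -/
structure IsExecution {d k n : ℕ} (x : Fin n → EuclideanSpace ℝ (Fin d)) (ω : Fin n → ℝ)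
    (κlo κhi : Fin k → ℝ) (s₀ : Sites d k) (N : ℕ)
    (s : ℕ → Sites d k) (y : ℕ → Assignment k n) : Prop where
  /-- The first iteration uses the input sites. -/
  start : s 0 = s₀
  /-- Step 1: an optimal vertex of the linear program for the current sites. -/
  assign : ∀ l < N, IsOptimalVertex x ω κlo κhi (s l) (y l)
  /-- Step 2: every site moves to the center of gravity of its cluster. -/
  update : ∀ l < N, ∀ i, s (l + 1) i = centerOfGravity x ω (y l) i
  /-- Iteration `l + 1` is followed by a further one only if it decreased the objective function
  value. (The first iteration has no previous value to be compared with.) -/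
  decrease : ∀ l, l + 2 < N → objective x ω (s (l + 1)) (y (l + 1)) < objective x ω (s l) (y l)

end WeightBalancedKMeans

/-! By LP duality an assignment is optimal for sites `s` iff there are multipliers `μ` of the size
constraints such that each point uses only clusters of least `cost x s i j + μ i`, and the signs of
`μ` fit the slack of the size bounds. Whether `(s, μ)` certifies a given assignment thus depends
only on finitely many signs (`IsDualCertificate.of_signPattern_eq`). With the heights `⟪s i, s i⟫ +
μ i` as variables, the cost comparisons are `n * k ^ 2` linear forms in `(d + 1) * k` variables, one
of which a common shift removes. So few patterns exist (`ncard_signPatterns_le`).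

If iterations `l` and `m ≥ l + 2` had the same pattern, `y l` would be optimal for `s m`. But `s (l
+ 1)` consists of the centers of gravity of `y l`, the best sites for it, so before the final
iteration strict descent makes `y m` better than `y l` for `s m`
(`IsExecution.objective_lt_of_add_one_lt`). Hence every second iteration has a new pattern
(`IsExecution.half_le`). -/

/-! ### Farkas' lemma for finitely many linear forms -/

/-- **Farkas' lemma**: a linear form that is nonnegative wherever finitely many linear forms are
is a conical combination of these. -/
theorem exists_nonneg_sum_smul_eq_of_forall_nonneg {V ι : Type*} [AddCommGroup V] [Module ℝ V]
    (s : Finset ι) (a : ι → Module.Dual ℝ V) (c : Module.Dual ℝ V)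
    (h : ∀ v, (∀ i ∈ s, 0 ≤ a i v) → 0 ≤ c v) :
    ∃ b : ι → ℝ, (∀ i, 0 ≤ b i) ∧ c = ∑ i ∈ s, b i • a i := by
  classical
  induction s using Finset.induction_on generalizing a c with
  | empty =>
    refine ⟨0, fun _ => le_rfl, ?_⟩
    ext v
    have h₁ := h v (by simp)
    have h₂ := h (-v) (by simp)
    rw [map_neg] at h₂
    simp only [Finset.sum_empty, LinearMap.zero_apply]
    linarith
  | insert i₀ s hi₀ ih =>
    by_cases hc : ∀ v, (∀ i ∈ s, 0 ≤ a i v) → 0 ≤ c v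
    · obtain ⟨b, hb, rfl⟩ := ih a c hc
      refine ⟨Function.update b i₀ 0, fun i => ?_, ?_⟩
      · by_cases hi : i = i₀
        · subst hi; simp
        · simpa [hi] using hb i
      · rw [Finset.sum_insert hi₀, Function.update_self, zero_smul, zero_add]
        refine Finset.sum_congr rfl fun i hi => ?_
        rw [Function.update_of_ne (ne_of_mem_of_not_mem hi hi₀)]
    · push Not at hc
      obtain ⟨u, hu, hcu⟩ := hc
      have hau : a i₀ u < 0 := by
        by_contra hcon
        refine absurd (h u fun i hi => ?_) (not_le.2 hcu)
        rcases Finset.mem_insert.1 hi with rfl | hi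
        · exact not_lt.1 hcon
        · exact hu i hi
      -- With this scaling, `v ↦ v + (a i₀ v * t) • u` projects along `u` onto the kernel of `a i₀`.
      -- The induction hypothesis is applied to the pullbacks of the other forms and of `c`.
      set t : ℝ := (-(a i₀ u))⁻¹ with ht
      have htpos : 0 < t := inv_pos.2 (neg_pos.2 hau)
      have hta : t * a i₀ u = -1 := by
        rw [ht, inv_neg, neg_mul, inv_mul_cancel₀ hau.ne]
      obtain ⟨b, hb, hbc⟩ := ih (fun i => a i + (t * a i u) • a i₀) (c + (t * c u) • a i₀)
        (fun v hv => by
          have := h (v + (a i₀ v * t) • u) (fun i hi => by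
            rcases Finset.mem_insert.1 hi with rfl | hi
            · simp only [map_add, map_smul, smul_eq_mul, mul_assoc, hta]
              simp
            · have := hv i hi
              simp only [LinearMap.add_apply, LinearMap.smul_apply, smul_eq_mul] at this
              simp only [map_add, map_smul, smul_eq_mul]
              linarith)
          simp only [map_add, map_smul, smul_eq_mul] at this
          simp only [LinearMap.add_apply, LinearMap.smul_apply, smul_eq_mul]
          linarith)
      refine ⟨Function.update b i₀ (∑ i ∈ s, b i * (t * a i u) - t * c u), fun i => ?_, ?_⟩
      · by_cases hi : i = i₀
        · subst hi
          rw [Function.update_self]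
          have h₁ : 0 ≤ ∑ i ∈ s, b i * (t * a i u) :=
            Finset.sum_nonneg fun i hi => mul_nonneg (hb i) (mul_nonneg htpos.le (hu i hi))
          have h₂ : t * c u < 0 := mul_neg_of_pos_of_neg htpos hcu
          linarith
        · simpa [hi] using hb i
      · rw [Finset.sum_insert hi₀, Function.update_self]
        have hsum : ∑ i ∈ s, Function.update b i₀ (∑ i ∈ s, b i * (t * a i u) - t * c u) i • a i
            = ∑ i ∈ s, b i • a i := by
          refine Finset.sum_congr rfl fun i hi => ?_
          rw [Function.update_of_ne (ne_of_mem_of_not_mem hi hi₀)]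
        rw [hsum]
        ext v
        have hv := LinearMap.congr_fun hbc v
        simp only [LinearMap.add_apply, LinearMap.smul_apply, LinearMap.sum_apply, smul_eq_mul,
          mul_add, Finset.sum_add_distrib] at hv ⊢
        rw [sub_mul, Finset.sum_mul]
        simp only [← mul_assoc] at hv ⊢
        linarith

/-! ### Sign vectors of linear forms -/

theorem sign_add_mul_eq {a b s t : ℝ} (hab : SignType.sign a = SignType.sign b)
    (hs : 0 ≤ s) (ht : 0 ≤ t) (hst : 0 < s + t) :
    SignType.sign (s * a + t * b) = SignType.sign a := by
  rcases lt_trichotomy a 0 with ha | rfl | ha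
  · have hb : b < 0 := by rwa [sign_neg ha, eq_comm, sign_eq_neg_one_iff] at hab
    rw [sign_neg ha, sign_eq_neg_one_iff]
    rcases hs.eq_or_lt with rfl | hs
    · nlinarith
    · nlinarith
  · have hb : b = 0 := by rwa [sign_zero, eq_comm, sign_eq_zero_iff] at hab
    simp [hb]
  · have hb : 0 < b := by rwa [sign_pos ha, eq_comm, sign_eq_one_iff] at hab
    rw [sign_pos ha, sign_eq_one_iff]
    rcases hs.eq_or_lt with rfl | hs
    · nlinarith
    · nlinarith

/-- If two vectors have the same signs on a family of linear forms, but different signs on a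
further form `ψ`, then some vector in the kernel of `ψ` has these signs, too. -/
theorem exists_mem_ker_sign_eq {V ι : Type*} [AddCommGroup V] [Module ℝ V]
    (φ : ι → Module.Dual ℝ V) (ψ : Module.Dual ℝ V) {v w : V}
    (hvw : ∀ i, SignType.sign (φ i v) = SignType.sign (φ i w))
    (hne : SignType.sign (ψ v) ≠ SignType.sign (ψ w)) :
    ∃ u ∈ LinearMap.ker ψ, ∀ i, SignType.sign (φ i u) = SignType.sign (φ i v) := by
  wlog hlt : ψ v < ψ w generalizing v w
  · have hlt' : ψ w < ψ v :=
      lt_of_le_of_ne (not_lt.1 hlt) fun h => hne (by rw [h])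
    obtain ⟨u, hu, hu'⟩ := this (fun i => (hvw i).symm) hne.symm hlt'
    exact ⟨u, hu, fun i => (hu' i).trans (hvw i).symm⟩
  have hv : ψ v ≤ 0 := by
    by_contra! h
    exact hne (by rw [sign_pos h, sign_pos (h.trans hlt)])
  have hw : 0 ≤ ψ w := by
    by_contra! h
    exact hne (by rw [sign_neg h, sign_neg (hlt.trans h)])
  -- This is a positive multiple of the point where the segment from `v` to `w` crosses the kernel
  -- of `ψ`.
  refine ⟨ψ w • v + (-ψ v) • w, ?_, fun i => ?_⟩
  · simp only [LinearMap.mem_ker, map_add, map_smul, smul_eq_mul]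
    ring
  · simp only [map_add, map_smul, smul_eq_mul]
    exact sign_add_mul_eq (hvw i) hw (neg_nonneg.2 hv) (by linarith)

/-- A central arrangement of `p` hyperplanes in an `r`-dimensional space has at most
`(3 * p + 1) ^ r` faces. -/
theorem ncard_range_sign_fin_le (p : ℕ) {V : Type*} [AddCommGroup V] [Module ℝ V]
    [FiniteDimensional ℝ V] (φ : Fin p → Module.Dual ℝ V) :
    (Set.range fun v i => SignType.sign (φ i v)).ncard ≤ (3 * p + 1) ^ Module.finrank ℝ V := by
  induction p generalizing V with
  | zero =>
    simpa using Set.ncard_le_one_of_subsingleton (Set.range fun v (i : Fin 0) =>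
      SignType.sign (φ i v))
  | succ p ih =>
    set R := Set.range fun v (i : Fin p) => SignType.sign (φ i.succ v) with hR
    have hRcard : R.ncard ≤ (3 * p + 1) ^ Module.finrank ℝ V := ih fun i => φ i.succ
    by_cases hφ : φ 0 = 0
    · have hsub : (Set.range fun v i => SignType.sign (φ i v)) ⊆
          (fun σ : Fin p → SignType => (Fin.cons 0 σ : Fin (p + 1) → SignType)) '' R := by
        rintro _ ⟨v, rfl⟩
        refine ⟨_, ⟨v, rfl⟩, ?_⟩
        funext i
        refine Fin.cases ?_ (fun i => ?_) i <;> simp [hφ]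
      calc _ ≤ _ := Set.ncard_le_ncard hsub
        _ ≤ _ := Set.ncard_image_le
        _ ≤ _ := hRcard
        _ ≤ _ := Nat.pow_le_pow_left (by omega) _
    · set R₀ := Set.range fun (v : LinearMap.ker (φ 0)) (i : Fin p) =>
        SignType.sign ((φ i.succ ∘ₗ (LinearMap.ker (φ 0)).subtype) v) with hR₀
      have hrank := Module.Dual.finrank_ker_add_one_of_ne_zero hφ
      have hR₀card : R₀.ncard ≤ (3 * p + 1) ^ Module.finrank ℝ (LinearMap.ker (φ 0)) :=
        ih fun i => φ i.succ ∘ₗ (LinearMap.ker (φ 0)).subtype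
      -- For each pattern of the last `p` forms, one sign `τ σ` of `φ 0` is set aside. Any other
      -- sign of `φ 0` forces the pattern to occur on the kernel as well, so at most `R.ncard + 3 *
      -- R₀.ncard` patterns arise.
      have hrep : ∀ σ : Fin p → SignType, ∃ t : SignType, σ ∈ R →
          ∃ v, (fun i : Fin p => SignType.sign (φ i.succ v)) = σ ∧
            SignType.sign (φ 0 v) = t := by
        intro σ
        by_cases hσ : σ ∈ R
        · obtain ⟨v, hv⟩ := hσ
          exact ⟨_, fun _ => ⟨v, hv, rfl⟩⟩
        · exact ⟨0, fun h => absurd h hσ⟩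
      choose τ hτ using hrep
      have hsub : (Set.range fun v i => SignType.sign (φ i v)) ⊆
          (fun σ : Fin p → SignType => (Fin.cons (τ σ) σ : Fin (p + 1) → SignType)) '' R ∪
          (fun q : SignType × (Fin p → SignType) =>
            (Fin.cons q.1 q.2 : Fin (p + 1) → SignType)) '' (Set.univ ×ˢ R₀) := by
        rintro _ ⟨w, rfl⟩
        have hcons : ∀ t, t = SignType.sign (φ 0 w) →
            (Fin.cons t (fun i : Fin p => SignType.sign (φ i.succ w)) : Fin (p + 1) → SignType)
              = fun i => SignType.sign (φ i w) := by
          rintro _ rfl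
          funext i
          refine Fin.cases ?_ (fun i => ?_) i <;> simp
        obtain ⟨v, hv, hv'⟩ := hτ (fun i => SignType.sign (φ i.succ w)) ⟨w, rfl⟩
        by_cases hs : SignType.sign (φ 0 v) = SignType.sign (φ 0 w)
        · exact Or.inl ⟨_, ⟨w, rfl⟩, hcons _ (hv' ▸ hs)⟩
        · obtain ⟨u, hu, hu'⟩ := exists_mem_ker_sign_eq (fun i : Fin p => φ i.succ) (φ 0)
            (fun i => congrFun hv i) hs
          refine Or.inr ⟨(SignType.sign (φ 0 w), fun i => SignType.sign (φ i.succ w)),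
            ⟨trivial, ⟨u, hu⟩, ?_⟩, hcons _ rfl⟩
          funext i
          exact (hu' i).trans (congrFun hv i)
      have hthree : (Set.univ : Set SignType).ncard = 3 := by
        rw [Set.ncard_univ, Nat.card_eq_fintype_card]; rfl
      calc _ ≤ _ := Set.ncard_le_ncard hsub
        _ ≤ _ := Set.ncard_union_le _ _
        _ ≤ R.ncard + (Set.univ ×ˢ R₀ : Set (SignType × (Fin p → SignType))).ncard :=
          add_le_add Set.ncard_image_le Set.ncard_image_le
        _ = R.ncard + 3 * R₀.ncard := by rw [Set.ncard_prod, hthree]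
        _ ≤ _ := add_le_add hRcard (Nat.mul_le_mul_left _ hR₀card)
        _ = (3 * p + 1) ^ Module.finrank ℝ (LinearMap.ker (φ 0)) * (3 * (p + 1) + 1) := by
          rw [← hrank]; ring
        _ ≤ (3 * (p + 1) + 1) ^ Module.finrank ℝ (LinearMap.ker (φ 0)) * (3 * (p + 1) + 1) :=
          Nat.mul_le_mul_right _ (Nat.pow_le_pow_left (by omega) _)
        _ = _ := by rw [← hrank, pow_succ]

theorem ncard_range_sign_le {ι V : Type*} [Fintype ι] [AddCommGroup V] [Module ℝ V]
    [FiniteDimensional ℝ V] (φ : ι → Module.Dual ℝ V) :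
    (Set.range fun v i => SignType.sign (φ i v)).ncard
      ≤ (3 * Fintype.card ι + 1) ^ Module.finrank ℝ V := by
  classical
  let e := Fintype.equivFin ι
  have hrange : (Set.range fun v i => SignType.sign (φ i v)) ⊆
      (fun σ : Fin (Fintype.card ι) → SignType => σ ∘ e) ''
        (Set.range fun v q => SignType.sign (φ (e.symm q) v)) := by
    rintro _ ⟨v, rfl⟩
    exact ⟨_, ⟨v, rfl⟩, by funext i; simp⟩
  calc _ ≤ _ := Set.ncard_le_ncard hrange
    _ ≤ _ := Set.ncard_image_le
    _ ≤ _ := ncard_range_sign_fin_le _ fun q => φ (e.symm q)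

namespace WeightBalancedKMeans

variable {d k n : ℕ} {x : Fin n → EuclideanSpace ℝ (Fin d)} {ω : Fin n → ℝ}
  {κlo κhi : Fin k → ℝ}

/-! ### Dual certificates of optimality -/

/-- The cost of assigning a unit of weight from point `j` to cluster `i`. -/
noncomputable def cost (x : Fin n → EuclideanSpace ℝ (Fin d)) (s : Sites d k)
    (i : Fin k) (j : Fin n) : ℝ :=
  inner ℝ (s i) (s i) - 2 * inner ℝ (x j) (s i)

/-- `μ` are multipliers of the cluster size constraints that satisfy complementary slackness
together with `y`. Geometrically, `y` respects the power diagram with sites `s` and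
weights `-μ`. -/
structure IsDualCertificate (x : Fin n → EuclideanSpace ℝ (Fin d)) (ω : Fin n → ℝ)
    (κlo κhi : Fin k → ℝ) (s : Sites d k) (y : Assignment k n) (μ : Fin k → ℝ) : Prop where
  cost_le : ∀ i j, y i j ≠ 0 → ∀ i', cost x s i j + μ i ≤ cost x s i' j + μ i'
  nonneg : ∀ i, κlo i < clusterSize ω y i → 0 ≤ μ i
  nonpos : ∀ i, clusterSize ω y i < κhi i → μ i ≤ 0

/-- The Lagrangian separates over the points, so it can be minimized one point at a time. -/
theorem objective_add_sum (s : Sites d k) (y : Assignment k n) (μ : Fin k → ℝ) :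
    objective x ω s y + ∑ i, μ i * clusterSize ω y i
      = ∑ j, ω j * ∑ i, y i j * (cost x s i j + μ i) := by
  have : ∀ i, μ i * clusterSize ω y i = ∑ j, y i j * ω j * μ i := fun i => by
    rw [clusterSize, Finset.mul_sum]
    exact Finset.sum_congr rfl fun j _ => by ring
  simp only [objective, this, ← Finset.sum_add_distrib]
  rw [Finset.sum_comm]
  refine Finset.sum_congr rfl fun j _ => ?_
  rw [Finset.mul_sum]
  exact Finset.sum_congr rfl fun i _ => by rw [cost]; ring

/-- Weak duality. -/
theorem IsDualCertificate.objective_le {s : Sites d k} {y z : Assignment k n} {μ : Fin k → ℝ}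
    (h : IsDualCertificate x ω κlo κhi s y μ) (hω : ∀ j, 0 < ω j)
    (hy : y ∈ partitionPolytope ω κlo κhi) (hz : z ∈ partitionPolytope ω κlo κhi) :
    objective x ω s y ≤ objective x ω s z := by
  obtain ⟨hysize, hysum, hy0⟩ := hy
  obtain ⟨hzsize, hzsum, hz0⟩ := hz
  have hpoint : ∑ j, ω j * ∑ i, y i j * (cost x s i j + μ i)
      ≤ ∑ j, ω j * ∑ i, z i j * (cost x s i j + μ i) := by
    refine Finset.sum_le_sum fun j _ => mul_le_mul_of_nonneg_left ?_ (hω j).le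
    obtain ⟨i₀, -, hi₀⟩ : ∃ i ∈ Finset.univ, y i j ≠ 0 :=
      Finset.exists_ne_zero_of_sum_ne_zero (by rw [hysum j]; exact one_ne_zero)
    calc ∑ i, y i j * (cost x s i j + μ i) ≤ ∑ i, y i j * (cost x s i₀ j + μ i₀) := by
          refine Finset.sum_le_sum fun i _ => ?_
          by_cases hi : y i j = 0
          · simp [hi]
          · exact mul_le_mul_of_nonneg_left (h.cost_le i j hi i₀) (hy0 i j)
      _ = ∑ i, z i j * (cost x s i₀ j + μ i₀) := by
          rw [← Finset.sum_mul, ← Finset.sum_mul, hysum, hzsum]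
      _ ≤ _ := Finset.sum_le_sum fun i _ =>
          mul_le_mul_of_nonneg_left (h.cost_le i₀ j hi₀ i) (hz0 i j)
  -- Complementary slackness: `μ i < 0` puts the size of cluster `i` at its lower bound, `0 < μ i`
  -- at its upper bound.
  have hsize : ∑ i, μ i * clusterSize ω z i ≤ ∑ i, μ i * clusterSize ω y i := by
    refine Finset.sum_le_sum fun i _ => ?_
    rcases lt_trichotomy (μ i) 0 with hμ | hμ | hμ
    · have := not_lt.1 fun hlt => absurd (h.nonneg i hlt) (not_le.2 hμ)
      exact mul_le_mul_of_nonpos_left (this.trans (hzsize i).1) hμ.le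
    · simp [hμ]
    · have := not_lt.1 fun hlt => absurd (h.nonpos i hlt) (not_le.2 hμ)
      exact mul_le_mul_of_nonneg_left ((hzsize i).2.trans this) hμ.le
  rw [← objective_add_sum, ← objective_add_sum] at hpoint
  linarith

/-- The `(i, j)`-th entry as a linear form. -/
def entryForm (i : Fin k) (j : Fin n) : Module.Dual ℝ (Assignment k n) :=
  (LinearMap.proj j : (Fin n → ℝ) →ₗ[ℝ] ℝ) ∘ₗ LinearMap.proj i

@[simp]
theorem entryForm_apply (i : Fin k) (j : Fin n) (y : Assignment k n) :
    entryForm i j y = y i j := rfl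

/-- The cluster size as a linear form. -/
noncomputable def sizeForm (ω : Fin n → ℝ) (i : Fin k) : Module.Dual ℝ (Assignment k n) :=
  ∑ j, ω j • entryForm i j

theorem sizeForm_apply (ω : Fin n → ℝ) (i : Fin k) (y : Assignment k n) :
    sizeForm ω i y = clusterSize ω y i := by
  simp [sizeForm, clusterSize, mul_comm]

/-- The objective as a linear form. -/
noncomputable def objectiveForm (x : Fin n → EuclideanSpace ℝ (Fin d)) (ω : Fin n → ℝ)
    (s : Sites d k) : Module.Dual ℝ (Assignment k n) :=
  ∑ i, ∑ j, (ω j * cost x s i j) • entryForm i j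

theorem objectiveForm_apply (s : Sites d k) (y : Assignment k n) :
    objectiveForm x ω s y = objective x ω s y := by
  simp only [objectiveForm, objective, LinearMap.sum_apply, LinearMap.smul_apply,
    entryForm_apply, smul_eq_mul, cost]
  exact Finset.sum_congr rfl fun i _ => Finset.sum_congr rfl fun j _ => by ring

/-- Here `a` is the slack of a constraint and `b` its rate of change: only tight constraints
restrict the direction of a short step. -/
theorem eventually_nonneg_add_mul {a b : ℝ} (ha : 0 ≤ a) (hb : a = 0 → 0 ≤ b) :
    ∀ᶠ ε in nhdsWithin (0 : ℝ) (Set.Ioi 0), 0 ≤ a + ε * b := by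
  rcases ha.eq_or_lt with rfl | ha
  · filter_upwards [self_mem_nhdsWithin] with ε hε
    have := mul_nonneg (le_of_lt hε) (hb rfl)
    linarith
  · have hcont : Filter.Tendsto (fun ε : ℝ => a + ε * b) (nhds 0) (nhds a) := by
      have : Continuous fun ε : ℝ => a + ε * b := by fun_prop
      simpa using this.tendsto 0
    exact (hcont.mono_left nhdsWithin_le_nhds).eventually (eventually_ge_nhds ha)

/-- The objective does not decrease in any feasible direction at a minimizer. -/
theorem objective_nonneg_of_feasible_direction {s : Sites d k} {y v : Assignment k n}
    (hy : y ∈ partitionPolytope ω κlo κhi)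
    (hmin : IsMinOn (objective x ω s) (partitionPolytope ω κlo κhi) y)
    (hsum : ∀ j, ∑ i, v i j = 0) (h0 : ∀ i j, y i j = 0 → 0 ≤ v i j)
    (hlo : ∀ i, clusterSize ω y i = κlo i → 0 ≤ clusterSize ω v i)
    (hhi : ∀ i, clusterSize ω y i = κhi i → clusterSize ω v i ≤ 0) :
    0 ≤ objective x ω s v := by
  obtain ⟨hysize, hysum, hy0⟩ := hy
  have e₁ : ∀ᶠ ε in nhdsWithin (0 : ℝ) (Set.Ioi 0), ∀ i j, 0 ≤ y i j + ε * v i j :=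
    Filter.eventually_all.2 fun i => Filter.eventually_all.2 fun j =>
      eventually_nonneg_add_mul (hy0 i j) (h0 i j)
  have e₂ : ∀ᶠ ε in nhdsWithin (0 : ℝ) (Set.Ioi 0),
      ∀ i, 0 ≤ (clusterSize ω y i - κlo i) + ε * clusterSize ω v i :=
    Filter.eventually_all.2 fun i => eventually_nonneg_add_mul (sub_nonneg.2 (hysize i).1)
      fun h => hlo i (sub_eq_zero.1 h)
  have e₃ : ∀ᶠ ε in nhdsWithin (0 : ℝ) (Set.Ioi 0),
      ∀ i, 0 ≤ (κhi i - clusterSize ω y i) + ε * (-clusterSize ω v i) :=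
    Filter.eventually_all.2 fun i => eventually_nonneg_add_mul (sub_nonneg.2 (hysize i).2)
      fun h => neg_nonneg.2 (hhi i (sub_eq_zero.1 h).symm)
  have e₄ : ∀ᶠ ε in nhdsWithin (0 : ℝ) (Set.Ioi 0), 0 < ε := self_mem_nhdsWithin
  obtain ⟨ε, h₁, h₂, h₃, hε⟩ := (e₁.and (e₂.and (e₃.and e₄))).exists
  have hsize : ∀ i, clusterSize ω (y + ε • v) i = clusterSize ω y i + ε * clusterSize ω v i :=
    fun i => by simp only [← sizeForm_apply, map_add, map_smul, smul_eq_mul]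
  have hmem : y + ε • v ∈ partitionPolytope ω κlo κhi := by
    refine ⟨fun i => ?_, fun j => ?_, fun i j => ?_⟩
    · rw [hsize]
      constructor
      · linarith [h₂ i]
      · linarith [h₃ i]
    · simp [Finset.sum_add_distrib, ← Finset.mul_sum, hsum, hysum]
    · simpa using h₁ i j
  have hle : objective x ω s y ≤ objective x ω s (y + ε • v) := hmin hmem
  rw [← objectiveForm_apply, ← objectiveForm_apply, map_add, map_smul, smul_eq_mul,
    objectiveForm_apply, objectiveForm_apply] at hle
  exact nonneg_of_mul_nonneg_right (by linarith) hε

/-- Strong duality. -/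
theorem exists_isDualCertificate {s : Sites d k} {y : Assignment k n} (hω : ∀ j, 0 < ω j)
    (hy : y ∈ partitionPolytope ω κlo κhi)
    (hmin : IsMinOn (objective x ω s) (partitionPolytope ω κlo κhi) y) :
    ∃ μ, IsDualCertificate x ω κlo κhi s y μ := by
  classical
  -- These forms cut out the cone of feasible directions at `y`. The equations enter with both
  -- signs, and constraints that are not tight become the zero form.
  let colForm : Fin n → Module.Dual ℝ (Assignment k n) := fun j =>
    ∑ i, entryForm i j
  have hcol : ∀ j v, colForm j v = ∑ i, v i j := fun j v => by simp [colForm]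
  let zeroForm : Fin k × Fin n → Module.Dual ℝ (Assignment k n) := fun q =>
    if y q.1 q.2 = 0 then entryForm q.1 q.2 else 0
  let loForm : Fin k → Module.Dual ℝ (Assignment k n) := fun i =>
    if clusterSize ω y i = κlo i then sizeForm ω i else 0
  let hiForm : Fin k → Module.Dual ℝ (Assignment k n) := fun i =>
    if clusterSize ω y i = κhi i then -sizeForm ω i else 0
  let a : (Fin n ⊕ Fin n) ⊕ (Fin k × Fin n) ⊕ (Fin k ⊕ Fin k) →
      Module.Dual ℝ (Assignment k n) :=
    Sum.elim (Sum.elim colForm (fun j => -colForm j))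
      (Sum.elim zeroForm (Sum.elim loForm hiForm))
  obtain ⟨b, hb, hbc⟩ := exists_nonneg_sum_smul_eq_of_forall_nonneg Finset.univ a
    (objectiveForm x ω s) (fun v hv => by
      rw [objectiveForm_apply]
      refine objective_nonneg_of_feasible_direction hy hmin (fun j => ?_) (fun i j hij => ?_)
        (fun i hi => ?_) (fun i hi => ?_)
      · have h₁ := hv (Sum.inl (Sum.inl j)) (Finset.mem_univ _)
        have h₂ := hv (Sum.inl (Sum.inr j)) (Finset.mem_univ _)
        simp only [a, Sum.elim_inl, Sum.elim_inr, LinearMap.neg_apply, hcol] at h₁ h₂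
        linarith
      · have := hv (Sum.inr (Sum.inl (i, j))) (Finset.mem_univ _)
        simpa [a, zeroForm, hij] using this
      · have := hv (Sum.inr (Sum.inr (Sum.inl i))) (Finset.mem_univ _)
        simpa [a, loForm, hi, sizeForm_apply] using this
      · have := hv (Sum.inr (Sum.inr (Sum.inr i))) (Finset.mem_univ _)
        simpa only [a, Sum.elim_inr, hiForm, if_pos hi, LinearMap.neg_apply, sizeForm_apply,
          neg_nonneg] using this)
  set α : Fin n → ℝ := fun j => b (Sum.inl (Sum.inl j)) - b (Sum.inl (Sum.inr j)) with hα
  set β : Fin k → Fin n → ℝ := fun i j => if y i j = 0 then b (Sum.inr (Sum.inl (i, j))) else 0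
    with hβ
  set lo : Fin k → ℝ := fun i =>
    if clusterSize ω y i = κlo i then b (Sum.inr (Sum.inr (Sum.inl i))) else 0 with hlo
  set hi : Fin k → ℝ := fun i =>
    if clusterSize ω y i = κhi i then b (Sum.inr (Sum.inr (Sum.inr i))) else 0 with hhi
  have hform : ∀ v : Assignment k n, objective x ω s v = ∑ j, α j * ∑ i, v i j
      + ∑ i, ∑ j, β i j * v i j + ∑ i, (lo i - hi i) * clusterSize ω v i := by
    intro v
    rw [← objectiveForm_apply, hbc]
    simp only [Fintype.sum_sum_type, LinearMap.add_apply, LinearMap.sum_apply,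
      LinearMap.smul_apply, smul_eq_mul, a, Sum.elim_inl, Sum.elim_inr, LinearMap.neg_apply, hcol,
      Fintype.sum_prod_type]
    have h₁ : ∀ i j, b (Sum.inr (Sum.inl (i, j))) * zeroForm (i, j) v = β i j * v i j := by
      intro i j
      by_cases h : y i j = 0 <;> simp [zeroForm, hβ, h]
    have h₂ : ∀ i, b (Sum.inr (Sum.inr (Sum.inl i))) * loForm i v = lo i * clusterSize ω v i := by
      intro i
      by_cases h : clusterSize ω y i = κlo i <;> simp [loForm, hlo, h, sizeForm_apply]
    have h₃ : ∀ i, b (Sum.inr (Sum.inr (Sum.inr i))) * hiForm i v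
        = -(hi i * clusterSize ω v i) := by
      intro i
      by_cases h : clusterSize ω y i = κhi i <;> simp [hiForm, hhi, h, sizeForm_apply]
    simp only [h₁, h₂, h₃, hα, sub_mul, Finset.sum_sub_distrib, Finset.sum_neg_distrib, mul_neg]
    ring
  -- Coefficients are compared by evaluating at matrix units.
  have hentry : ∀ i j, ω j * cost x s i j = α j + β i j + (lo i - hi i) * ω j := by
    intro i j
    have := hform (Pi.single i (Pi.single j 1))
    have hs : ∀ (g : Fin k → Fin n → ℝ),
        ∑ i', ∑ j', g i' j' * (Pi.single i (Pi.single j (1 : ℝ)) : Assignment k n) i' j'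
          = g i j := by
      intro g
      rw [Finset.sum_eq_single i, Finset.sum_eq_single j]
      · simp
      · intro j' _ hj'; simp [hj']
      · simp
      · intro i' _ hi'; simp [hi']
      · simp
    have h₁ : objective x ω s (Pi.single i (Pi.single j (1 : ℝ)) : Assignment k n)
        = ω j * cost x s i j := by
      rw [← hs fun i j => ω j * cost x s i j, objective]
      exact Finset.sum_congr rfl fun i _ => Finset.sum_congr rfl fun j _ => by rw [cost]; ring
    have h₂ : ∑ j', α j' * ∑ i', (Pi.single i (Pi.single j (1 : ℝ)) : Assignment k n) i' j'
        = α j := by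
      rw [← hs fun _ j => α j, Finset.sum_comm]
      exact Finset.sum_congr rfl fun j _ => by rw [Finset.mul_sum]
    have h₃ : ∑ i', (lo i' - hi i') *
        clusterSize ω (Pi.single i (Pi.single j (1 : ℝ)) : Assignment k n) i'
          = (lo i - hi i) * ω j := by
      rw [← hs fun i j => (lo i - hi i) * ω j]
      refine Finset.sum_congr rfl fun i _ => ?_
      rw [clusterSize, Finset.mul_sum]
      exact Finset.sum_congr rfl fun j _ => by ring
    rw [h₁, h₂, h₃, hs] at this
    exact this
  have hβ0 : ∀ i j, 0 ≤ β i j := fun i j => by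
    by_cases h : y i j = 0 <;> simp [hβ, h, hb]
  -- For this `μ`, `hentry` reads `ω j * (cost x s i j + μ i) = α j + β i j`, which is least where
  -- `β` vanishes, in particular on the support of `y`.
  refine ⟨fun i => hi i - lo i, fun i j hij i' => ?_, fun i h => ?_, fun i h => ?_⟩
  · have h₁ := hentry i j
    have h₂ := hentry i' j
    have h₃ : β i j = 0 := by simp [hβ, hij]
    refine le_of_mul_le_mul_left ?_ (hω j)
    linarith [hβ0 i' j]
  · have h₁ : lo i = 0 := by simp [hlo, h.ne']
    have h₂ : 0 ≤ hi i := by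
      by_cases h : clusterSize ω y i = κhi i <;> simp [hhi, h, hb]
    simp only [h₁]; linarith
  · have h₁ : hi i = 0 := by simp [hhi, h.ne]
    have h₂ : 0 ≤ lo i := by
      by_cases h : clusterSize ω y i = κlo i <;> simp [hlo, h, hb]
    simp only [h₁]; linarith

/-! ### Sign patterns of sites and multipliers -/

/-- Lifted sites: `(s, γ)` stands for the affine functions `p ↦ γ i - 2 * ⟪p, s i⟫`. -/
abbrev LiftedSites (d k : ℕ) := Sites d k × (Fin k → ℝ)

/-- The difference of the affine functions of clusters `i` and `i'` at the point `x j`. -/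
noncomputable def comparisonForm (x : Fin n → EuclideanSpace ℝ (Fin d))
    (q : Fin n × Fin k × Fin k) : Module.Dual ℝ (LiftedSites d k) where
  toFun p := (p.2 q.2.1 - 2 * inner ℝ (x q.1) (p.1 q.2.1))
    - (p.2 q.2.2 - 2 * inner ℝ (x q.1) (p.1 q.2.2))
  map_add' p p' := by
    simp only [Prod.fst_add, Prod.snd_add, Pi.add_apply, inner_add_right]
    ring
  map_smul' c p := by
    simp only [Prod.smul_fst, Prod.smul_snd, Pi.smul_apply, inner_smul_right, smul_eq_mul,
      RingHom.id_apply]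
    ring

/-- The height of the `i₀`-th lifted site. -/
noncomputable def heightForm (d : ℕ) (i₀ : Fin k) : Module.Dual ℝ (LiftedSites d k) :=
  LinearMap.proj i₀ ∘ₗ LinearMap.snd ℝ (Sites d k) (Fin k → ℝ)

/-- Fixing one height at zero costs nothing, as only height differences enter the comparisons; it
saves the `1` in the exponent. -/
theorem finrank_ker_heightForm (i₀ : Fin k) :
    Module.finrank ℝ (LinearMap.ker (heightForm d i₀)) = (d + 1) * k - 1 := by
  have hne : heightForm d i₀ ≠ 0 := fun h => by
    have := LinearMap.congr_fun h ((0, fun _ => 1) : LiftedSites d k)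
    simp [heightForm] at this
  have h := Module.Dual.finrank_ker_add_one_of_ne_zero hne
  have hV : Module.finrank ℝ (LiftedSites d k) = (d + 1) * k := by
    simp [Module.finrank_prod, Module.finrank_pi_fintype]
    ring
  omega

/-- Lifted sites of a power diagram, shifted such that the `i₀`-th height vanishes. -/
noncomputable def lift (i₀ : Fin k) (s : Sites d k) (μ : Fin k → ℝ) : LiftedSites d k :=
  (s, fun i => (inner ℝ (s i) (s i) + μ i) - (inner ℝ (s i₀) (s i₀) + μ i₀))

theorem lift_mem_ker (i₀ : Fin k) (s : Sites d k) (μ : Fin k → ℝ) :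
    lift i₀ s μ ∈ LinearMap.ker (heightForm d i₀) := by
  simp [lift, heightForm]

/-- The height absorbs the quadratic term of the cost, which makes the comparison linear; the shift
by the height of `i₀` cancels. -/
theorem comparisonForm_lift (i₀ : Fin k) (s : Sites d k) (μ : Fin k → ℝ) (j : Fin n)
    (i i' : Fin k) :
    comparisonForm x (j, i, i') (lift i₀ s μ)
      = (cost x s i j + μ i) - (cost x s i' j + μ i') := by
  simp only [comparisonForm, lift, cost, LinearMap.coe_mk, AddHom.coe_mk]
  ring

/-- The sign pattern of sites and multipliers. -/
noncomputable def signPattern (x : Fin n → EuclideanSpace ℝ (Fin d)) (i₀ : Fin k)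
    (s : Sites d k) (μ : Fin k → ℝ) :
    (Fin n × Fin k × Fin k → SignType) × (Fin k → SignType) :=
  (fun q => SignType.sign (comparisonForm x q (lift i₀ s μ)), fun i => SignType.sign (μ i))

theorem nonpos_iff_of_sign_eq {a b : ℝ} (h : SignType.sign a = SignType.sign b) :
    a ≤ 0 ↔ b ≤ 0 := by
  rw [← not_lt, ← not_lt, ← sign_eq_one_iff, ← sign_eq_one_iff, h]

theorem nonneg_iff_of_sign_eq {a b : ℝ} (h : SignType.sign a = SignType.sign b) :
    0 ≤ a ↔ 0 ≤ b := by
  rw [← not_lt, ← not_lt, ← sign_eq_neg_one_iff, ← sign_eq_neg_one_iff, h]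

/-- Whether multipliers certify optimality depends on the sign pattern only. -/
theorem IsDualCertificate.of_signPattern_eq {i₀ : Fin k} {s s' : Sites d k} {y : Assignment k n}
    {μ μ' : Fin k → ℝ} (h : IsDualCertificate x ω κlo κhi s y μ)
    (heq : signPattern x i₀ s μ = signPattern x i₀ s' μ') :
    IsDualCertificate x ω κlo κhi s' y μ' := by
  have hμ : ∀ i, SignType.sign (μ i) = SignType.sign (μ' i) :=
    fun i => congrFun (congrArg Prod.snd heq) i
  refine ⟨fun i j hij i' => ?_, fun i hi => ?_, fun i hi => ?_⟩
  · have hq : SignType.sign (comparisonForm x (j, i, i') (lift i₀ s μ))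
        = SignType.sign (comparisonForm x (j, i, i') (lift i₀ s' μ')) :=
      congrFun (congrArg Prod.fst heq) (j, i, i')
    rw [comparisonForm_lift, comparisonForm_lift] at hq
    exact sub_nonpos.1 ((nonpos_iff_of_sign_eq hq).1 (sub_nonpos.2 (h.cost_le i j hij i')))
  · exact (nonneg_iff_of_sign_eq (hμ i)).1 (h.nonneg i hi)
  · exact (nonpos_iff_of_sign_eq (hμ i)).1 (h.nonpos i hi)

/-- The normalized lift forgets the signs of `μ`, so they are counted separately, by the crude
factor `3 ^ k`. -/
theorem ncard_signPatterns_le (x : Fin n → EuclideanSpace ℝ (Fin d)) (i₀ : Fin k) :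
    (Set.range fun p : Sites d k × (Fin k → ℝ) => signPattern x i₀ p.1 p.2).ncard
      ≤ (3 * (n * (k * k)) + 1) ^ ((d + 1) * k - 1) * 3 ^ k := by
  have hsub : (Set.range fun p : Sites d k × (Fin k → ℝ) => signPattern x i₀ p.1 p.2) ⊆
      (Set.range fun (v : LinearMap.ker (heightForm d i₀)) (q : Fin n × Fin k × Fin k) =>
        SignType.sign ((comparisonForm x q ∘ₗ (LinearMap.ker (heightForm d i₀)).subtype) v))
        ×ˢ Set.univ := by
    rintro _ ⟨p, rfl⟩
    exact ⟨⟨⟨_, lift_mem_ker i₀ p.1 p.2⟩, rfl⟩, trivial⟩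
  have hcount := ncard_range_sign_le fun q : Fin n × Fin k × Fin k =>
    comparisonForm x q ∘ₗ (LinearMap.ker (heightForm d i₀)).subtype
  have huniv : (Set.univ : Set (Fin k → SignType)).ncard = 3 ^ k := by
    rw [Set.ncard_univ, Nat.card_eq_fintype_card, Fintype.card_fun, Fintype.card_fin]; rfl
  rw [finrank_ker_heightForm] at hcount
  simp only [Fintype.card_prod, Fintype.card_fin] at hcount
  calc _ ≤ _ := Set.ncard_le_ncard hsub
    _ = _ := Set.ncard_prod
    _ ≤ _ := Nat.mul_le_mul hcount huniv.le

/-! ### Descent -/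

/-- The centers of gravity are optimal sites for a given assignment. -/
theorem objective_centerOfGravity_le {y : Assignment k n} (hy : ∀ i, 0 < clusterSize ω y i)
    (s : Sites d k) :
    objective x ω (centerOfGravity x ω y) y ≤ objective x ω s y := by
  have hcluster : ∀ (s : Sites d k) (i : Fin k),
      ∑ j, y i j * ω j * (inner ℝ (s i) (s i) - 2 * inner ℝ (x j) (s i))
        = clusterSize ω y i * (inner ℝ (s i) (s i)
          - 2 * inner ℝ (centerOfGravity x ω y i) (s i)) := by
    intro s i
    have hinner : clusterSize ω y i * inner ℝ (centerOfGravity x ω y i) (s i)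
        = ∑ j, y i j * ω j * inner ℝ (x j) (s i) := by
      rw [centerOfGravity, real_inner_smul_left, mul_inv_cancel_left₀ (hy i).ne', sum_inner]
      exact Finset.sum_congr rfl fun j _ => real_inner_smul_left _ _ _
    rw [mul_sub, mul_left_comm, hinner, clusterSize, Finset.sum_mul, Finset.mul_sum,
      ← Finset.sum_sub_distrib]
    exact Finset.sum_congr rfl fun j _ => by ring
  refine Finset.sum_le_sum fun i _ => ?_
  rw [hcluster, hcluster]
  refine mul_le_mul_of_nonneg_left ?_ (hy i).le
  -- Per unit of cluster weight, the two sides differ by the squared distance from `s i` to the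
  -- center of gravity.
  have h := real_inner_self_nonneg (F := EuclideanSpace ℝ (Fin d))
    (x := s i - centerOfGravity x ω y i)
  rw [real_inner_sub_sub_self, real_inner_comm (centerOfGravity x ω y i) (s i)] at h
  linarith

variable {s₀ : Sites d k} {N : ℕ} {s : ℕ → Sites d k} {y : ℕ → Assignment k n}

/-- Iteration `N - 1` is excluded because it may be the one that fails to decrease the objective and
stops the run. -/
theorem IsExecution.objective_lt (h : IsExecution x ω κlo κhi s₀ N s y) {l m : ℕ} (hlm : l < m)
    (hm : m + 1 < N) : objective x ω (s m) (y m) < objective x ω (s l) (y l) := by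
  induction m, hlm using Nat.le_induction with
  | base => exact h.decrease l hm
  | succ m _ ih => exact (h.decrease m hm).trans (ih (by omega))

/-- For two iterations that are not consecutive, the last one excluded, the earlier assignment is
not optimal for the later sites. -/
theorem IsExecution.objective_lt_of_add_one_lt (h : IsExecution x ω κlo κhi s₀ N s y)
    (hκlo : ∀ i, 0 < κlo i) {l m : ℕ} (hlm : l + 1 < m) (hm : m + 1 < N) :
    objective x ω (s m) (y m) < objective x ω (s m) (y l) := by
  have hyl := (h.assign l (by omega)).1.1
  have hs : s (l + 1) = centerOfGravity x ω (y l) := funext (h.update l (by omega))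
  calc objective x ω (s m) (y m) < objective x ω (s (l + 1)) (y (l + 1)) :=
        h.objective_lt hlm hm
    _ ≤ objective x ω (s (l + 1)) (y l) := (h.assign (l + 1) (by omega)).2 hyl
    _ ≤ objective x ω (s m) (y l) := by
        rw [hs]
        exact objective_centerOfGravity_le (fun i => (hκlo i).trans_le (hyl.1 i).1) _

/-- Up to consecutive iterations and the last one, different iterations have different sign
patterns. -/
theorem IsExecution.half_le (h : IsExecution x ω κlo κhi s₀ N s y) (hω : ∀ j, 0 < ω j)
    (hκlo : ∀ i, 0 < κlo i) (i₀ : Fin k) :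
    N / 2 ≤ (3 * (n * (k * k)) + 1) ^ ((d + 1) * k - 1) * 3 ^ k := by
  have hdual : ∀ l, ∃ μ, l < N → IsDualCertificate x ω κlo κhi (s l) (y l) μ := by
    intro l
    by_cases hl : l < N
    · obtain ⟨μ, hμ⟩ := exists_isDualCertificate hω (h.assign l hl).1.1 (h.assign l hl).2
      exact ⟨μ, fun _ => hμ⟩
    · exact ⟨0, fun h => absurd h hl⟩
  choose μ hμ using hdual
  -- Even indices are never consecutive, and `m < N / 2` keeps `2 * m` below the last iteration.
  have hne : ∀ l m, l < m → m < N / 2 →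
      signPattern x i₀ (s (2 * l)) (μ (2 * l)) ≠ signPattern x i₀ (s (2 * m)) (μ (2 * m)) := by
    intro l m hlm hm heq
    have hcert := (hμ (2 * l) (by omega)).of_signPattern_eq heq
    have hle := hcert.objective_le hω (h.assign (2 * l) (by omega)).1.1
      (h.assign (2 * m) (by omega)).1.1
    exact absurd hle (not_le.2 (h.objective_lt_of_add_one_lt hκlo (by omega) (by omega)))
  refine le_trans ?_ (ncard_signPatterns_le x i₀)
  rw [← Nat.card_Iio (N / 2), ← Set.ncard_coe_finset]
  refine Set.ncard_le_ncard_of_injOn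
    (fun l => signPattern x i₀ (s (2 * l)) (μ (2 * l))) (fun l _ => ⟨(_, _), rfl⟩) ?_
  intro l hl m hm heq
  simp only [Finset.coe_Iio, Set.mem_Iio] at hl hm
  rcases lt_trichotomy l m with hlt | rfl | hlt
  · exact absurd heq (hne l m hlt hm)
  · rfl
  · exact absurd heq.symm (hne m l hlt hl)

end WeightBalancedKMeans

/-! ### From the pattern count to the stated bound -/

theorem theorem5p3 (d k n : ℕ) (hk : 2 ≤ k) (hkn : k ≤ n)
    (x : Fin n → EuclideanSpace ℝ (Fin d)) (hx : Function.Injective x)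
    (ω : Fin n → ℝ) (hω : ∀ j, 0 < ω j)
    (κlo κhi : Fin k → ℝ) (hκlo : ∀ i, 0 < κlo i) (hκ : ∀ i, κlo i ≤ κhi i)
    (hlo : ∑ i, κlo i ≤ ∑ j, ω j) (hhi : ∑ j, ω j ≤ ∑ i, κhi i)
    (s₀ : WeightBalancedKMeans.Sites d k) (N : ℕ)
    (s : ℕ → WeightBalancedKMeans.Sites d k) (y : ℕ → WeightBalancedKMeans.Assignment k n)
    (hrun : WeightBalancedKMeans.IsExecution x ω κlo κhi s₀ N s y) :
    (N : ℝ) ≤ (40 * Real.exp 1 * (k : ℝ) ^ 2 * (n : ℝ)) ^ ((d + 1) * k - 1) := by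
  -- A zero-dimensional space has no room for the `n ≥ 2` distinct points.
  have hd : 1 ≤ d := by
    by_contra hd
    obtain rfl : d = 0 := by omega
    have h := congrArg Fin.val
      (hx (Subsingleton.elim (x ⟨0, by omega⟩) (x ⟨1, by omega⟩)))
    simp at h
  have hhalf := hrun.half_le hω hκlo ⟨0, by omega⟩
  -- This lets `3 ^ M` absorb both the sign factor `3 ^ k` and the factor `3` lost in passing from
  -- `N / 2` to `N`. The base becomes `3 * (4 * A) = 12 * A`, below the required one.
  have hexp : k + 1 ≤ (d + 1) * k - 1 := by
    have : 2 * k ≤ (d + 1) * k := Nat.mul_le_mul_right _ (by omega)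
    omega
  set M := (d + 1) * k - 1
  set A := n * (k * k)
  have hA : 1 ≤ A := Nat.mul_pos (by omega) (Nat.mul_pos (by omega) (by omega))
  have hbound : N ≤ (12 * A) ^ M := by
    have hpos : 1 ≤ (3 * A + 1) ^ M * 3 ^ k := Nat.mul_pos (by positivity) (by positivity)
    calc N ≤ 2 * ((3 * A + 1) ^ M * 3 ^ k) + 1 := by omega
      _ ≤ 3 * ((3 * A + 1) ^ M * 3 ^ k) := by omega
      _ = (3 * A + 1) ^ M * 3 ^ (k + 1) := by ring
      _ ≤ (4 * A) ^ M * 3 ^ M :=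
        Nat.mul_le_mul (Nat.pow_le_pow_left (by omega) _) (Nat.pow_le_pow_right (by norm_num) hexp)
      _ = (12 * A) ^ M := by rw [← mul_pow]; ring
  calc (N : ℝ) ≤ ((12 * A) ^ M : ℕ) := by exact_mod_cast hbound
    _ = (12 * ((k : ℝ) ^ 2 * n)) ^ M := by simp only [A]; push_cast; ring
    _ ≤ (40 * Real.exp 1 * (k : ℝ) ^ 2 * (n : ℝ)) ^ M := by
      refine pow_le_pow_left₀ (by positivity) ?_ _
      have he : (1 : ℝ) ≤ Real.exp 1 := Real.one_le_exp zero_le_one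
      rw [mul_assoc (40 * Real.exp 1)]
      exact mul_le_mul_of_nonneg_right (by linarith) (by positivity)
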